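/- Let $[n,\overline n]=\{1,\dots,n,\overline 1,\dots,\overline n\}$ with the involution $i\leftrightarrow\overline i$, applied elementwise to subsets, and let $\mathrm{AdS}_n$ be the set of admissible subsets of $[n,\overline n]$, i.e. those containing at most one of $i$ and $\overline i$ for each $i\in[n]$. For $S\in\mathrm{AdS}_n$ put $e_S=\sum_{a\in S}e_a\in\mathbb R^n$, where $e_1,\dots,e_n$ is the standard basis and $e_{\overline i}=-e_i$. A delta-matroid $D$ on $[n,\overline n]$ is a non-empty collection $\mathcal F$ of admissible sets of size $n$ such that every edge of the polytope $P(D)=\mathrm{Conv}\{e_B : B\in\mathcal F\}$ is parallel to $e_i$ for some $i$ or to $e_i+e_j$ or $e_i-e_j$ for some $i\ne j$; $D$ is even if every edge of $P(D)$ is parallel to $e_i+e_j$ or $e_i-e_j$ for some $i\neq j$. The rank function of $D$ is $$g_D\colon\mathrm{AdS}_n\to\mathbb Z,\qquad g_D(S)=\max_{B\in\mathcal F}\bigl(|S\cap B|-|\overline S\cap B|\bigr).$$ For $S,T\in\mathrm{AdS}_n$ let $S\sqcup T=\{a\in S\cup T : \overline a\notin S\cup T\}$. **Theorem.** A function $g\colon\mathrm{AdS}_n\to\mathbb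 Z$ is the rank function of a delta-matroid on $[n,\overline n]$ if and only if 1. $g(\emptyset)=0$, 2. $|g(S)|\le 1$ whenever $|S|=1$, 3. $g(S)+g(T)\ge g(S\cap T)+g(S\sqcup T)$ for all $S,T\in\mathrm{AdS}_n$, and 4. $g(S)\equiv|S|\pmod 2$ for all $S\in\mathrm{AdS}_n$. Furthermore, a delta-matroid $D$ on $[n,\overline n]$ is even if and only if $$g_D(S)=\frac{g_D(S\cup\{i\})+g_D(S\cup\{\overline i\})}{2}$$ for all $S\in\mathrm{AdS}_n$ and $i\in[n]$ with $|S|=n-1$ and $S\cap\{i,\overline i\}=\emptyset$. -/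

import Mathlib

/-- The ground set `[n, n̄] = {1, …, n, 1̄, …, n̄}`: `Sum.inl i` is the element `i` and
`Sum.inr i` is the element `ī`. -/
abbrev SignedGround (n : ℕ) : Type := Fin n ⊕ Fin n

/-- A subset of `[n, n̄]` is admissible if it contains at most one of `i` and `ī` for each `i`. -/
def IsAdmissible {n : ℕ} (S : Finset (SignedGround n)) : Prop :=
  ∀ i : Fin n, ¬ (Sum.inl i ∈ S ∧ Sum.inr i ∈ S)

/-- The set `AdS_n` of admissible subsets of `[n, n̄]`. -/
abbrev AdS (n : ℕ) : Type := {S : Finset (SignedGround n) // IsAdmissible S}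

namespace AdS

variable {n : ℕ}

/-- The involution applied to a set: `S̄ = {ā : a ∈ S}`. -/
def bar (S : AdS n) : Finset (SignedGround n) := S.1.image Sum.swap

/-- The empty admissible set. -/
def empty (n : ℕ) : AdS n := ⟨∅, fun _ h => Finset.notMem_empty _ h.1⟩

/-- `S ∩ T` as an admissible set. -/
def inter (S T : AdS n) : AdS n :=
  ⟨S.1 ∩ T.1, fun i h =>
    S.2 i ⟨(Finset.mem_inter.1 h.1).1, (Finset.mem_inter.1 h.2).1⟩⟩

/-- `S ⊔ T = {a ∈ S ∪ T : ā ∉ S ∪ T}` as an admissible set. -/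
def sqUnion (S T : AdS n) : AdS n :=
  ⟨(S.1 ∪ T.1).filter (fun a => a.swap ∉ S.1 ∪ T.1), fun _ h =>
    (Finset.mem_filter.1 h.1).2 (Finset.mem_filter.1 h.2).1⟩

/-- `S ∪ {a}` as an admissible set, for `S` not containing `ā`. -/
def adjoin (S : AdS n) (a : SignedGround n) (ha : a.swap ∉ S.1) : AdS n :=
  ⟨insert a S.1, fun i h => by
    rcases Finset.mem_insert.1 h.1 with h1 | h1 <;> rcases Finset.mem_insert.1 h.2 with h2 | h2
    · exact absurd (h1.trans h2.symm) Sum.inl_ne_inr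
    · exact ha (h1 ▸ h2)
    · exact ha (h2 ▸ h1)
    · exact S.2 i ⟨h1, h2⟩⟩

/-- The vector `e_a ∈ ℝⁿ`, where `e_i` is a standard basis vector and `e_ī = -e_i`. -/
def elemVec : SignedGround n → (Fin n → ℝ)
  | Sum.inl i => Pi.single i 1
  | Sum.inr i => -Pi.single i 1

/-- The vector `e_S = ∑_{a ∈ S} e_a ∈ ℝⁿ`. -/
def vec (S : AdS n) : Fin n → ℝ := ∑ a ∈ S.1, elemVec a

end AdS

/-- `F` is an edge of the polytope `P`: a face (the set of maximizers on `P` of a linear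
functional) of dimension one. -/
def IsEdge {n : ℕ} (P F : Set (Fin n → ℝ)) : Prop :=
  IsExposed ℝ P F ∧ Module.finrank ℝ (vectorSpan ℝ F) = 1

/-- `F` is parallel to the line through the vector `v`. -/
def IsParallelTo {n : ℕ} (F : Set (Fin n → ℝ)) (v : Fin n → ℝ) : Prop :=
  vectorSpan ℝ F = Submodule.span ℝ {v}

/-- `F` is parallel to `e_i + e_j` or to `e_i - e_j` for some distinct `i` and `j`. -/
def IsParallelToPair {n : ℕ} (F : Set (Fin n → ℝ)) : Prop :=
  ∃ i j : Fin n, i ≠ j ∧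
    (IsParallelTo F (Pi.single i 1 + Pi.single j 1) ∨
      IsParallelTo F (Pi.single i 1 - Pi.single j 1))

/-- The polytope `Conv {e_B : B ∈ 𝓕}` of a collection `𝓕` of admissible sets. -/
def feasiblePolytope {n : ℕ} (𝓕 : Finset (AdS n)) : Set (Fin n → ℝ) :=
  convexHull ℝ (AdS.vec '' (𝓕 : Set (AdS n)))

/-- A delta-matroid on `[n, n̄]`: a non-empty collection of admissible sets of size `n`, the
feasible sets, such that every edge of `Conv {e_B : B feasible}` is parallel to some `e_i` or
some `e_i ± e_j`. -/
structure DeltaMatroid (n : ℕ) where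
  /-- The feasible sets. -/
  feasible : Finset (AdS n)
  nonempty : feasible.Nonempty
  card_eq : ∀ B ∈ feasible, B.1.card = n
  edges : ∀ F, IsEdge (feasiblePolytope feasible) F →
    (∃ i : Fin n, IsParallelTo F (Pi.single i 1)) ∨ IsParallelToPair F

namespace DeltaMatroid

variable {n : ℕ}

/-- The polytope `P(D)`. -/
def polytope (D : DeltaMatroid n) : Set (Fin n → ℝ) := feasiblePolytope D.feasible

/-- `D` is even if all edges of `P(D)` are parallel to some `e_i ± e_j`, `i ≠ j`. -/
def IsEven (D : DeltaMatroid n) : Prop := ∀ F, IsEdge D.polytope F → IsParallelToPair F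

/-- The rank function `g_D(S) = max_{B feasible} (|S ∩ B| - |S̄ ∩ B|)`. -/
def rank (D : DeltaMatroid n) (S : AdS n) : ℤ :=
  D.feasible.sup' D.nonempty
    (fun B => ((S.1 ∩ B.1).card : ℤ) - ((S.bar ∩ B.1).card : ℤ))

end DeltaMatroid

/-- `g` is bisubmodular: `g(S) + g(T) ≥ g(S ∩ T) + g(S ⊔ T)` for all admissible `S`, `T`. -/
def IsBisubmodular {n : ℕ} {R : Type*} [Add R] [LE R] (g : AdS n → R) : Prop :=
  ∀ S T : AdS n, g S + g T ≥ g (S.inter T) + g (S.sqUnion T)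

/-! Encode admissible sets as sign vectors and those of size `n` as vertices of the cube, so that
`g_D` is the support function of `P(D)` on sign vectors.

A feasible `C` whose difference with a feasible `A` is minimal among those containing a given
coordinate spans an edge with `A`; hence the edge directions are the prescribed ones if and only if
the feasible sets satisfy the symmetric exchange property. Exchange makes every local maximum of a
linear functional a global one. Applied to the sum of `S ∩ T` and `S ⊔ T`, this yields one feasible
set that attains both `g_D(S ∩ T)` and `g_D(S ⊔ T)`, and bisubmodularity follows.

Conversely, parity and bisubmodularity force `g` to change by `±1` whenever one element is added, so
a greedy choice of signs along a chain builds vertices that are tight on the chain and satisfy all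
inequalities of `g`: the function `g` is the support function of these vertices. Their exchange
property comes from uncrossing: the sign vectors tight at `A` and opposite to `A` at `i` have a
least element, and any coordinate where it agrees with `A` may be switched together with `i`.

An edge in direction `e_i` amounts to two feasible sets differing at `i` only, and these make the
rank identity fail at their common part. Without them all differences of feasible sets are even,
and a parity count gives the identity.
-/

open scoped symmDiff

/-- Sign vectors over `ι`. An admissible set `S` is encoded by the sign vector with value `1` at
`i` when `i ∈ S`, `-1` when `ī ∈ S`, and `0` otherwise. -/
abbrev SignVec (ι : Type*) : Type _ := ι → SignType

namespace SignVec

variable {ι : Type*}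

/-- The coordinatewise meet of sign vectors, which encodes `S ∩ T`. -/
def meet (s t : SignVec ι) : SignVec ι := fun i => if s i = t i then s i else 0

/-- The coordinatewise join of sign vectors, with opposite signs cancelling; it encodes `S ⊔ T`. -/
def join (s t : SignVec ι) : SignVec ι := fun i =>
  if s i = 0 then t i else if t i = 0 ∨ s i = t i then s i else 0

/-- The order on sign vectors that encodes the inclusion of admissible sets. -/
def IsBelow (s t : SignVec ι) : Prop := ∀ i, s i = 0 ∨ s i = t i

theorem zero_isBelow (s : SignVec ι) : IsBelow 0 s := fun _ => Or.inl rfl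

theorem meet_isBelow_right (s t : SignVec ι) : IsBelow (meet s t) t := fun i => by
  unfold meet
  split_ifs with h <;> simp [h]

theorem meet_isBelow_join (s t : SignVec ι) : IsBelow (meet s t) (join s t) := fun i => by
  simp only [meet, join]
  generalize s i = a; generalize t i = b
  decide +revert

theorem join_isBelow_right (s : SignVec ι) {t : SignVec ι} (ht : ∀ i, t i ≠ 0) :
    IsBelow (join s t) t := fun i => by
  have := ht i
  simp only [join]
  generalize s i = a; generalize t i = b at *
  revert a b; decide

theorem meet_add_join (s t : SignVec ι) (i : ι) :
    (meet s t i : ℤ) + (join s t i : ℤ) = s i + t i := by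
  simp only [meet, join]
  generalize s i = a; generalize t i = b
  decide +revert

section Single

variable [DecidableEq ι] {s : SignVec ι} {i : ι} {a : SignType}

theorem meet_single_eq_zero (h : s i ≠ a) : meet s (Pi.single i a) = 0 := by
  funext k
  rcases eq_or_ne k i with rfl | hk <;> simp [meet, *]

theorem join_single (h : s i = 0) : join s (Pi.single i a) = Function.update s i a := by
  funext k
  rcases eq_or_ne k i with rfl | hk <;> simp +contextual [join, *]

theorem join_update_single_neg (h : s i = 0) (ha : a ≠ 0) :
    join (Function.update s i a) (Pi.single i (-a)) = s := by
  funext k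
  rcases eq_or_ne k i with rfl | hk <;> simp +contextual [join, *, SignType.self_eq_neg_iff]

namespace IsBelow

variable {t : SignVec ι} (hs : IsBelow s (Function.update t i a))
include hs

theorem update_zero : IsBelow (Function.update s i 0) t := fun k => by
  rcases eq_or_ne k i with rfl | hk
  · simp
  · simpa [hk] using hs k

theorem apply_eq (hi : s i ≠ 0) : s i = a := by
  simpa [hi] using hs i

theorem meet_eq (ht : t i = 0) (hi : s i ≠ 0) : meet s t = Function.update s i 0 :=
    funext fun k => by
  rcases eq_or_ne k i with rfl | hk
  · simp [meet, ht, hi]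
  · rcases hs k with h | h <;> simp_all [meet]

theorem join_eq (ht : t i = 0) (hi : s i ≠ 0) : join s t = Function.update t i a :=
    funext fun k => by
  rcases eq_or_ne k i with rfl | hk
  · simp +contextual [join, ht, hs.apply_eq hi]
  · rcases hs k with h | h <;> simp_all [join]

end IsBelow

end Single

section Vertex

variable [DecidableEq ι]

/-- The sign vector of the vertex of the cube `[-1, 1]^ι` at which exactly the coordinates in `A`
are positive. The admissible sets of size `n` are the ones encoded by vertices. -/
def vertex (A : Finset ι) : SignVec ι := fun i => if i ∈ A then 1 else -1

theorem vertex_ne_zero (A : Finset ι) (i : ι) : vertex A i ≠ 0 := by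
  unfold vertex
  split_ifs <;> decide

theorem vertex_eq_one_iff {A : Finset ι} {i : ι} : vertex A i = 1 ↔ i ∈ A := by
  simp [vertex]

theorem vertex_injective : Function.Injective (vertex : Finset ι → SignVec ι) := fun A B h =>
  Finset.ext fun i => by rw [← vertex_eq_one_iff, h, vertex_eq_one_iff]

theorem exists_vertex_eq [Finite ι] {s : SignVec ι} (hs : ∀ i, s i ≠ 0) :
    ∃ A : Finset ι, vertex A = s :=
  ⟨(Set.toFinite {i | s i = 1}).toFinset, funext fun i => by
    have := hs i
    simp only [vertex, Set.Finite.mem_toFinset, Set.mem_ofPred_eq]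
    generalize s i = a at *
    decide +revert⟩

theorem vertex_symmDiff (A I : Finset ι) (i : ι) :
    vertex (A ∆ I) i = if i ∈ I then -vertex A i else vertex A i := by
  by_cases hA : i ∈ A <;> by_cases hI : i ∈ I <;> simp [vertex, Finset.mem_symmDiff, hA, hI]

theorem mem_symmDiff_iff_vertex {A B : Finset ι} {i : ι} :
    i ∈ A ∆ B ↔ vertex B i = -vertex A i := by
  by_cases hA : i ∈ A <;> by_cases hB : i ∈ B <;>
    simp [vertex, Finset.mem_symmDiff, hA, hB]

theorem notMem_symmDiff_iff_vertex {A B : Finset ι} {i : ι} :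
    i ∉ A ∆ B ↔ vertex B i = vertex A i := by
  by_cases hA : i ∈ A <;> by_cases hB : i ∈ B <;>
    simp [vertex, Finset.mem_symmDiff, hA, hB]

theorem apply_mul_vertex_cases (s : SignVec ι) (A : Finset ι) (i : ι) :
    s i = -vertex A i ∧ (s i : ℤ) * vertex A i = -1 ∨ s i = 0 ∧ (s i : ℤ) * vertex A i = 0 ∨
      s i = vertex A i ∧ (s i : ℤ) * vertex A i = 1 := by
  have := vertex_ne_zero A i
  generalize s i = a; generalize vertex A i = b at *
  revert a b; decide

end Vertex

section Weight

variable [DecidableEq ι] [Fintype ι] {R : Type*} [Ring R]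

/-- The value at the vertex `A` of the linear functional with coefficients `w`. -/
def weight (w : ι → R) (A : Finset ι) : R := ∑ k, w k * (vertex A k : R)

theorem weight_symmDiff (w : ι → R) (A I : Finset ι) :
    weight w (A ∆ I) = weight w A - 2 * ∑ k ∈ I, w k * (vertex A k : R) := by
  have hI : ∑ k ∈ I, w k * (vertex A k : R) = ∑ k, if k ∈ I then w k * (vertex A k : R) else 0 := by
    simp
  rw [weight, weight, hI, Finset.mul_sum, ← Finset.sum_sub_distrib]
  refine Finset.sum_congr rfl fun k _ => ?_
  by_cases hk : k ∈ I <;> simp [vertex_symmDiff, hk, two_mul]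

section Order

variable [LinearOrder R] [IsStrictOrderedRing R] {w : ι → R} {A I : Finset ι}

theorem weight_symmDiff_le_iff :
    weight w (A ∆ I) ≤ weight w A ↔ 0 ≤ ∑ k ∈ I, w k * (vertex A k : R) := by
  rw [weight_symmDiff, sub_le_self_iff, mul_nonneg_iff_of_pos_left two_pos]

theorem weight_le_weight_symmDiff_iff :
    weight w A ≤ weight w (A ∆ I) ↔ ∑ k ∈ I, w k * (vertex A k : R) ≤ 0 := by
  rw [weight_symmDiff, le_sub_self_iff, mul_nonpos_iff_pos_imp_nonpos]
  simp

end Order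

/-- The value `|S ∩ B| - |S̄ ∩ B|`, for `S` encoded by `s` and `B` by the vertex `A`. -/
def pairing (s : SignVec ι) (A : Finset ι) : ℤ := weight (fun k => (s k : ℤ)) A

theorem pairing_zero (A : Finset ι) : pairing 0 A = 0 := by
  simp [pairing, weight]

theorem pairing_symmDiff (s : SignVec ι) (A I : Finset ι) :
    pairing s (A ∆ I) = pairing s A - 2 * ∑ k ∈ I, (s k : ℤ) * vertex A k :=
  weight_symmDiff _ A I

theorem pairing_update (s : SignVec ι) (i : ι) (a : SignType) (A : Finset ι) :
    pairing (Function.update s i a) A = pairing s A + ((a : ℤ) - s i) * vertex A i := by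
  rw [← sub_eq_iff_eq_add', pairing, pairing, weight, weight, ← Finset.sum_sub_distrib,
    Finset.sum_eq_single i (fun k _ hk => by simp [hk]) (by simp)]
  simp [sub_mul]

theorem pairing_congr {s : SignVec ι} {A B : Finset ι}
    (h : ∀ k, s k = 0 ∨ vertex A k = vertex B k) : pairing s A = pairing s B :=
  Finset.sum_congr rfl fun k _ => by rcases h k with h | h <;> simp [h]

theorem pairing_meet_add_pairing_join (s t : SignVec ι) (A : Finset ι) :
    pairing (meet s t) A + pairing (join s t) A = pairing s A + pairing t A := by
  simp only [pairing, weight, ← Finset.sum_add_distrib, ← add_mul, meet_add_join]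

theorem pairing_modEq (s : SignVec ι) (A : Finset ι) :
    pairing s A ≡ ∑ k, (s k : ℤ) [ZMOD 2] :=
  Int.ModEq.sum fun k _ => by
    have := vertex_ne_zero A k
    beta_reduce
    generalize s k = a; generalize vertex A k = b at *
    revert a b; decide

end Weight

section Exchange

variable [DecidableEq ι]

/-- The symmetric exchange property: the family of vertices `F` is a delta-matroid in the sense of
Bouchet. The case `j = i` is the one in which the sign of `i` alone changes. -/
def SymmetricExchange (F : Set (Finset ι)) : Prop :=
  ∀ A ∈ F, ∀ B ∈ F, ∀ i ∈ A ∆ B, ∃ j ∈ A ∆ B, A ∆ {i, j} ∈ F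

theorem exists_forall_sum_pair_nonpos {R : Type*} [AddCommGroup R] [LinearOrder R]
    [IsOrderedAddMonoid R] {M : Finset ι} (hM : M.Nonempty) {d : ι → R}
    (h : ∀ i ∈ M, ∃ j ∈ M, ∑ k ∈ {i, j}, d k ≤ 0) :
    ∃ i ∈ M, ∀ j ∈ M, ∑ k ∈ {i, j}, d k ≤ 0 := by
  -- With `|d m|` maximal, `h` yields some `d i ≤ -|d m|`, which outweighs every other value.
  obtain ⟨m, hm, hmax⟩ := M.exists_max_image (fun k => |d k|) hM
  obtain ⟨i, hi, hdi⟩ : ∃ i ∈ M, d i ≤ -|d m| := by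
    rcases le_or_gt (d m) 0 with hd | hd
    · exact ⟨m, hm, by rw [abs_of_nonpos hd, neg_neg]⟩
    · obtain ⟨j, hj, hsum⟩ := h m hm
      have hmj : m ≠ j := by
        rintro rfl
        simp only [Finset.pair_eq_singleton, Finset.sum_singleton] at hsum
        exact hsum.not_gt hd
      rw [Finset.sum_pair hmj] at hsum
      exact ⟨j, hj, by rw [abs_of_pos hd]; exact le_neg_iff_add_nonpos_left.2 hsum⟩
  refine ⟨i, hi, fun j hj => ?_⟩
  rcases eq_or_ne i j with rfl | hij
  · simpa using hdi.trans (neg_nonpos.2 (abs_nonneg _))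
  · rw [Finset.sum_pair hij]
    calc d i + d j ≤ -|d m| + |d m| := add_le_add hdi ((le_abs_self _).trans (hmax j hj))
      _ = 0 := neg_add_cancel _

theorem symmDiff_symmDiff_ssubset {A X I : Finset ι} (hI : I.Nonempty) (h : I ⊆ A ∆ X) :
    A ∆ (X ∆ I) ⊂ A ∆ X := by
  rw [← symmDiff_assoc, symmDiff_of_ge h]
  exact Finset.sdiff_ssubset h hI

namespace SymmetricExchange

variable [Fintype ι] {F : Set (Finset ι)} {R : Type*} [Ring R] [LinearOrder R]
  [IsStrictOrderedRing R] {w : ι → R} {A X : Finset ι}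

theorem exists_weight_le (hF : SymmetricExchange F) (hA : A ∈ F)
    (hloc : ∀ i j, A ∆ {i, j} ∈ F → weight w (A ∆ {i, j}) ≤ weight w A)
    (hX : X ∈ F) (hXA : X ≠ A) :
    ∃ i ∈ A ∆ X, ∃ j ∈ A ∆ X, X ∆ {i, j} ∈ F ∧ weight w X ≤ weight w (X ∆ {i, j}) := by
  -- Pairs that do not raise the weight at `A` do not lower it at `X`, where all signs are opposite.
  have hpair : ∀ i ∈ A ∆ X, ∃ j ∈ A ∆ X, ∑ k ∈ {i, j}, w k * (vertex X k : R) ≤ 0 := by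
    intro i hi
    obtain ⟨j, hj, hij⟩ := hF A hA X hX i hi
    have hneg : ∑ k ∈ {i, j}, w k * (vertex X k : R) = -∑ k ∈ {i, j}, w k * (vertex A k : R) := by
      rw [← Finset.sum_neg_distrib]
      refine Finset.sum_congr rfl fun k hk => ?_
      have hk : k ∈ A ∆ X := by
        rcases Finset.mem_insert.1 hk with rfl | hk
        exacts [hi, Finset.mem_singleton.1 hk ▸ hj]
      rw [mem_symmDiff_iff_vertex.1 hk, SignType.coe_neg, mul_neg]
    refine ⟨j, hj, ?_⟩
    rw [hneg, neg_nonpos, ← weight_symmDiff_le_iff]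
    exact hloc i j hij
  obtain ⟨i, hi, hmin⟩ := exists_forall_sum_pair_nonpos
    (Finset.symmDiff_nonempty.2 hXA.symm) hpair
  obtain ⟨j, hj, hij⟩ := hF X hX A hA i (symmDiff_comm A X ▸ hi)
  rw [symmDiff_comm] at hj
  exact ⟨i, hi, j, hj, hij, weight_le_weight_symmDiff_iff.2 (hmin j hj)⟩

theorem weight_le_of_local_max (hF : SymmetricExchange F) (hA : A ∈ F)
    (hloc : ∀ i j, A ∆ {i, j} ∈ F → weight w (A ∆ {i, j}) ≤ weight w A) (hX : X ∈ F) :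
    weight w X ≤ weight w A := by
  induction h : A ∆ X using Finset.strongInduction generalizing X with
  | H M ih =>
    rcases eq_or_ne X A with rfl | hXA
    · exact le_rfl
    · obtain ⟨i, hi, j, hj, hmem, hle⟩ := hF.exists_weight_le hA hloc hX hXA
      have hlt := symmDiff_symmDiff_ssubset (Finset.insert_nonempty i {j})
        (Finset.insert_subset hi (Finset.singleton_subset_iff.2 hj))
      exact hle.trans (ih _ (h ▸ hlt) hmem rfl)

theorem exists_maximizes_both (hF : SymmetricExchange F) (hne : F.Nonempty) {s t : SignVec ι}
    (hst : IsBelow s t) :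
    ∃ A ∈ F, (∀ X ∈ F, pairing s X ≤ pairing s A) ∧ ∀ X ∈ F, pairing t X ≤ pairing t A := by
  -- As `s` and `t` do not disagree in sign, no exchange at a maximizer of `s + t` can raise one of
  -- the two pairings at the expense of the other.
  obtain ⟨A, hA, hmax⟩ := Set.exists_max_image F
    (weight fun k => (s k : ℤ) + t k) (Set.toFinite F) hne
  have hsigns : ∀ k, ((s k : ℤ) * vertex A k = 0 ∨ (s k : ℤ) * vertex A k = t k * vertex A k) ∧
      |(t k : ℤ) * vertex A k| ≤ 1 := fun k => by
    have := hst k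
    generalize s k = a at *; generalize t k = b at *; generalize vertex A k = c
    decide +revert
  have hloc : ∀ i j, A ∆ {i, j} ∈ F → pairing s (A ∆ {i, j}) ≤ pairing s A ∧
      pairing t (A ∆ {i, j}) ≤ pairing t A := by
    intro i j hij
    have hle := weight_symmDiff_le_iff.1 (hmax _ hij)
    rw [pairing_symmDiff, pairing_symmDiff]
    have hi := hsigns i
    have hj := hsigns j
    rw [abs_le] at hi hj
    rcases eq_or_ne i j with rfl | hne
    · simp only [Finset.pair_eq_singleton, Finset.sum_singleton, add_mul] at hle ⊢
      omega
    · simp only [Finset.sum_pair hne, add_mul] at hle ⊢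
      omega
  exact ⟨A, hA, fun X => hF.weight_le_of_local_max hA fun i j h => (hloc i j h).1,
    fun X => hF.weight_le_of_local_max hA fun i j h => (hloc i j h).2⟩

end SymmetricExchange

/-- The cost of switching the sign of the coordinate `k`, chosen so that switching all of `M` is
free while switching a nonempty set that omits `i` or leaves `M` is not. -/
def switchCost (M : Finset ι) (i k : ι) : ℝ :=
  if k = i then 1 - M.card else if k ∈ M then 1 else M.card

theorem sum_switchCost_self {M : Finset ι} {i : ι} (hi : i ∈ M) :
    ∑ k ∈ M, switchCost M i k = 0 := by
  have hrest : ∑ k ∈ M.erase i, switchCost M i k = ∑ k ∈ M.erase i, 1 :=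
    Finset.sum_congr rfl fun k hk => by
      rw [Finset.mem_erase] at hk
      simp [switchCost, hk]
  rw [← Finset.add_sum_erase M _ hi, hrest, Finset.sum_const, Finset.card_erase_of_mem hi,
    nsmul_one, Nat.cast_pred (Finset.card_pos.2 ⟨i, hi⟩), switchCost, if_pos rfl]
  ring

theorem sum_switchCost_pos {M N : Finset ι} {i : ι} (hi : i ∈ M) (hN : N.Nonempty)
    (h : i ∈ N → ¬N ⊆ M) : 0 < ∑ k ∈ N, switchCost M i k := by
  have hcard : (0 : ℝ) < M.card := Nat.cast_pos.2 (Finset.card_pos.2 ⟨i, hi⟩)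
  have hpos : ∀ k, k ≠ i → 0 < switchCost M i k := fun k hk => by
    by_cases hkM : k ∈ M <;> simp [switchCost, hk, hkM, hcard]
  by_cases hiN : i ∈ N
  · obtain ⟨x, hx, hxM⟩ := Finset.not_subset.1 (h hiN)
    have hxi : x ≠ i := fun h => hxM (h ▸ hi)
    have hrest : 0 ≤ ∑ k ∈ (N.erase i).erase x, switchCost M i k :=
      Finset.sum_nonneg fun k hk =>
        (hpos k (Finset.ne_of_mem_erase (Finset.mem_of_mem_erase hk))).le
    rw [← Finset.add_sum_erase N _ hiN,
      ← Finset.add_sum_erase _ _ (Finset.mem_erase.2 ⟨hxi, hx⟩)]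
    have hi_cost : switchCost M i i = 1 - M.card := if_pos rfl
    have hx_cost : switchCost M i x = M.card := by simp [switchCost, hxi, hxM]
    linarith
  · exact Finset.sum_pos (fun k hk => hpos k fun h => hiN (h ▸ hk)) hN

variable [Fintype ι] {F : Set (Finset ι)} {A B : Finset ι}

/-- `A` and `B` are the endpoints of an edge of the polytope spanned by the family of vertices `F`:
they are the only maximizers over `F` of some linear functional. -/
structure IsEdgePair (F : Set (Finset ι)) (A B : Finset ι) : Prop where
  ne : A ≠ B
  exists_weight : ∃ w : ι → ℝ, {C ∈ F | ∀ D ∈ F, weight w D ≤ weight w C} = {A, B}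

theorem IsEdgePair.mem (h : IsEdgePair F A B) : A ∈ F ∧ B ∈ F := by
  obtain ⟨w, hw⟩ := h.exists_weight
  have hAB : {A, B} ⊆ F := hw ▸ Set.sep_subset F _
  exact Set.pair_subset_iff.1 hAB

theorem SymmetricExchange.card_symmDiff_le_two (hF : SymmetricExchange F)
    (h : IsEdgePair F A B) : (A ∆ B).card ≤ 2 := by
  obtain ⟨w, hw⟩ := h.exists_weight
  have hA : ∀ C ∈ F, weight w C ≤ weight w A := (hw.ge (Set.mem_insert A {B})).2
  have hB : ∀ C ∈ F, weight w C ≤ weight w B := (hw.ge (Set.mem_insert_of_mem A rfl)).2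
  obtain ⟨i, -, j, -, hmem, hle⟩ :=
    hF.exists_weight_le h.mem.1 (fun i j hij => hA _ hij) h.mem.2 h.ne.symm
  have hBA : B ∆ {i, j} = A :=
    (hw.le ⟨hmem, fun C hC => (hB C hC).trans hle⟩).resolve_right (by simp [symmDiff_eq_left])
  have hAB : A ∆ B = {i, j} := by rw [← hBA, symmDiff_comm, symmDiff_symmDiff_cancel_left]
  exact hAB ▸ Finset.card_le_two

theorem weight_mul_vertex_symmDiff (c : ι → ℝ) (A I : Finset ι) :
    weight (fun k => c k * vertex A k) (A ∆ I) =
      weight (fun k => c k * vertex A k) A - 2 * ∑ k ∈ I, c k := by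
  rw [weight_symmDiff]
  congr 2
  refine Finset.sum_congr rfl fun k _ => ?_
  by_cases hk : k ∈ A <;> simp [vertex, hk]

theorem isEdgePair_of_minimal {i : ι} (hA : A ∈ F) (hB : B ∈ F) (hi : i ∈ A ∆ B)
    (hmin : ∀ C ∈ F, i ∈ A ∆ C → A ∆ C ⊆ A ∆ B → C = B) : IsEdgePair F A B := by
  let w : ι → ℝ := fun k => switchCost (A ∆ B) i k * vertex A k
  have hweight (C : Finset ι) :
      weight w C = weight w A - 2 * ∑ k ∈ A ∆ C, switchCost (A ∆ B) i k := by
    rw [← weight_mul_vertex_symmDiff, symmDiff_symmDiff_cancel_left]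
  have hB_eq : weight w B = weight w A := by
    rw [hweight B, sum_switchCost_self hi, mul_zero, sub_zero]
  have hlt : ∀ C ∈ F, C ≠ A → C ≠ B → weight w C < weight w A := fun C hC hCA hCB => by
    have hpos := sum_switchCost_pos hi (Finset.symmDiff_nonempty.2 hCA.symm)
      fun hiC hsub => hCB (hmin C hC hiC hsub)
    linarith [hweight C]
  have hmax : ∀ C ∈ F, weight w C ≤ weight w A := fun C hC => by
    by_cases hCA : C = A
    · rw [hCA]
    · by_cases hCB : C = B
      exacts [hCB ▸ hB_eq.le, (hlt C hC hCA hCB).le]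
  refine ⟨fun hAB => by simp [hAB] at hi, w, Set.ext fun C => ⟨fun ⟨hC, hCmax⟩ => ?_, ?_⟩⟩
  · by_contra hne
    rw [Set.mem_insert_iff, Set.mem_singleton_iff, not_or] at hne
    exact (hlt C hC hne.1 hne.2).not_ge (hCmax A hA)
  · rintro (rfl | rfl)
    exacts [⟨hA, hmax⟩, ⟨hB, fun C hC => (hmax C hC).trans hB_eq.ge⟩]

theorem exists_isEdgePair {i : ι} (hA : A ∈ F) (hB : B ∈ F) (hi : i ∈ A ∆ B) :
    ∃ C, IsEdgePair F A C ∧ i ∈ A ∆ C ∧ A ∆ C ⊆ A ∆ B := by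
  obtain ⟨C, ⟨hC, hiC, hCB⟩, hmin⟩ := Set.Finite.exists_minimalFor (A ∆ ·)
    {C | C ∈ F ∧ i ∈ A ∆ C ∧ A ∆ C ⊆ A ∆ B} (Set.toFinite _) ⟨B, hB, hi, subset_rfl⟩
  refine ⟨C, isEdgePair_of_minimal hA hC hiC fun Z hZ hiZ hZC => ?_, hiC, hCB⟩
  exact symmDiff_right_injective A (hZC.antisymm (hmin ⟨hZ, hiZ, hZC.trans hCB⟩ hZC))

theorem symmetricExchange_iff_forall_isEdgePair :
    SymmetricExchange F ↔ ∀ A B, IsEdgePair F A B → (A ∆ B).card ≤ 2 := by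
  refine ⟨fun hF A B => hF.card_symmDiff_le_two, fun h A hA B hB i hi => ?_⟩
  obtain ⟨C, hedge, hiC, hCB⟩ := exists_isEdgePair hA hB hi
  obtain ⟨j, hij⟩ : ∃ j, A ∆ C = {i, j} := by
    rcases (Nat.le_add_one_iff.1 (h A C hedge)) with hcard | hcard
    · exact ⟨i, by
        rw [Finset.pair_eq_singleton]
        exact Finset.eq_singleton_iff_unique_mem.2
          ⟨hiC, fun k hk => Finset.card_le_one.1 hcard k hk i hiC⟩⟩
    · obtain ⟨x, y, -, hxy⟩ := Finset.card_eq_two.1 hcard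
      rw [hxy, Finset.mem_insert, Finset.mem_singleton] at hiC
      rcases hiC with rfl | rfl
      exacts [⟨y, hxy⟩, ⟨x, hxy.trans (Finset.pair_comm _ _)⟩]
  refine ⟨j, hCB (by simp [hij]), ?_⟩
  rw [← hij, symmDiff_symmDiff_cancel_left]
  exact hedge.mem.2

end Exchange

section RankFunction

variable [DecidableEq ι] [Fintype ι]

/-- The four conditions of the theorem, for a function of sign vectors. -/
structure IsRankFunction (g : SignVec ι → ℤ) : Prop where
  zero : g 0 = 0
  abs_single_le : ∀ (i : ι) (a : SignType), a ≠ 0 → |g (Pi.single i a)| ≤ 1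
  bisubmodular : ∀ s t, g (meet s t) + g (join s t) ≤ g s + g t
  modEq : ∀ s, g s ≡ ∑ k, (s k : ℤ) [ZMOD 2]

/-- `g` is the support function of the polytope spanned by the family of vertices `F`, restricted
to sign vectors. -/
def IsSupportFunction (F : Set (Finset ι)) (g : SignVec ι → ℤ) : Prop :=
  ∀ s, IsGreatest (pairing s '' F) (g s)

variable {F : Set (Finset ι)} {g : SignVec ι → ℤ}

theorem IsSupportFunction.pairing_le (hg : IsSupportFunction F g) (s : SignVec ι) {A : Finset ι}
    (hA : A ∈ F) : pairing s A ≤ g s :=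
  (hg s).2 (Set.mem_image_of_mem _ hA)

theorem IsSupportFunction.bisubmodular (hg : IsSupportFunction F g) (hF : SymmetricExchange F)
    (s t : SignVec ι) : g (meet s t) + g (join s t) ≤ g s + g t := by
  obtain ⟨A, hA, hmeet, hjoin⟩ := hF.exists_maximizes_both
    (Set.image_nonempty.1 (hg 0).nonempty) (meet_isBelow_join s t)
  calc g (meet s t) + g (join s t) ≤ pairing (meet s t) A + pairing (join s t) A :=
        add_le_add ((isLUB_le_iff (hg _).isLUB).2 (Set.forall_mem_image.2 hmeet))
          ((isLUB_le_iff (hg _).isLUB).2 (Set.forall_mem_image.2 hjoin))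
    _ = pairing s A + pairing t A := pairing_meet_add_pairing_join s t A
    _ ≤ g s + g t := add_le_add (hg.pairing_le s hA) (hg.pairing_le t hA)

theorem IsSupportFunction.isRankFunction (hg : IsSupportFunction F g)
    (hF : SymmetricExchange F) : IsRankFunction g where
  zero := by
    obtain ⟨A, -, hA⟩ := (hg 0).1
    rw [← hA, pairing_zero]
  abs_single_le i a _ := by
    obtain ⟨A, -, hA⟩ := (hg (Pi.single i a)).1
    have hsign : ∀ a b : SignType, |0 + ((a : ℤ) - (0 : SignType)) * b| ≤ 1 := by decide
    rw [← hA, Pi.single, pairing_update, pairing_zero]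
    exact hsign a _
  bisubmodular := hg.bisubmodular hF
  modEq s := by
    obtain ⟨A, -, hA⟩ := (hg s).1
    exact hA ▸ pairing_modEq s A

/-- The vertices of the cube that satisfy all the inequalities prescribed by `g`. -/
def feasibleVertices (g : SignVec ι → ℤ) : Set (Finset ι) := {A | ∀ s, pairing s A ≤ g s}

/-- The vertex `A` satisfies the inequalities prescribed by `g` on all sign vectors below `c`, with
equality at `c`. Only the coordinates at which `c` does not vanish matter. -/
structure IsTightBelow (g : SignVec ι → ℤ) (c : SignVec ι) (A : Finset ι) : Prop where
  pairing_le : ∀ s, IsBelow s c → pairing s A ≤ g s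
  pairing_eq : pairing c A = g c

/-- The slack at the vertex `A` of the inequality prescribed by `g` on `s`. -/
def slack (g : SignVec ι → ℤ) (A : Finset ι) (s : SignVec ι) : ℤ := g s - pairing s A

/-- `s` is the least of the sign vectors that are tight at `A` and opposite to `A` at `i`. -/
structure IsLeastTightAgainst (g : SignVec ι → ℤ) (A : Finset ι) (i : ι) (s : SignVec ι) :
    Prop where
  slack_eq : slack g A s = 0
  apply_eq : s i = -vertex A i
  isBelow : ∀ t, slack g A t = 0 → t i = -vertex A i → IsBelow s t

section Slack

variable {A B : Finset ι} {s : SignVec ι} {i : ι}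

theorem slack_nonneg (hA : A ∈ feasibleVertices g) (s : SignVec ι) : 0 ≤ slack g A s :=
  sub_nonneg.2 (hA s)

theorem slack_symmDiff (g : SignVec ι → ℤ) (s : SignVec ι) (A I : Finset ι) :
    slack g (A ∆ I) s = slack g A s + 2 * ∑ k ∈ I, (s k : ℤ) * vertex A k := by
  rw [slack, slack, pairing_symmDiff]
  ring

theorem exists_apply_eq_vertex (hB : B ∈ feasibleVertices g) (hi : i ∈ A ∆ B)
    (hs : slack g A s = 0) (hsi : s i = -vertex A i) : ∃ j ∈ A ∆ B, s j = vertex A j := by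
  by_contra! hne
  have hterm : ∀ k ∈ A ∆ B, (s k : ℤ) * vertex A k ≤ 0 := fun k hk => by
    rcases apply_mul_vertex_cases s A k with ⟨-, h⟩ | ⟨-, h⟩ | ⟨h, -⟩
    exacts [h ▸ by norm_num, h.le, absurd h (hne k hk)]
  have hterm_i : (s i : ℤ) * vertex A i < 0 := by
    rcases apply_mul_vertex_cases s A i with ⟨-, h⟩ | ⟨h, -⟩ | ⟨h, -⟩
    · exact h ▸ by norm_num
    · exact absurd (hsi.symm.trans h) (by simpa using vertex_ne_zero A i)
    · exact absurd h (hne i hi)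
  have hsum := Finset.sum_lt_sum hterm ⟨i, hi, hterm_i⟩
  rw [Finset.sum_const_zero] at hsum
  have hB_slack := slack_nonneg hB s
  rw [← symmDiff_symmDiff_cancel_left A B, slack_symmDiff, hs] at hB_slack
  linarith

end Slack

namespace IsRankFunction

section Greedy

variable (hg : IsRankFunction g) {c d : SignVec ι} {A : Finset ι}
include hg

theorem modEq_pairing (s : SignVec ι) (A : Finset ι) : g s ≡ pairing s A [ZMOD 2] :=
  (hg.modEq s).trans (pairing_modEq s A).symm

theorem update_sub_eq_one_or {i : ι} (hc : c i = 0) {a : SignType} (ha : a ≠ 0) :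
    g (Function.update c i a) - g c = 1 ∨ g (Function.update c i a) - g c = -1 := by
  have hupper := hg.bisubmodular c (Pi.single i a)
  rw [meet_single_eq_zero (hc ▸ ha.symm), join_single hc, hg.zero] at hupper
  have hlower := hg.bisubmodular (Function.update c i a) (Pi.single i (-a))
  rw [meet_single_eq_zero (by simpa [SignType.self_eq_neg_iff] using ha),
    join_update_single_neg hc ha, hg.zero] at hlower
  have hparity := (hg.modEq_pairing (Function.update c i a) ∅).sub (hg.modEq_pairing c ∅)
  have hodd : ((a : ℤ) - c i) * vertex ∅ i ≡ 1 [ZMOD 2] := by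
    have hv := vertex_ne_zero ∅ i
    rw [hc]
    generalize vertex ∅ i = b at *
    clear hupper hlower hparity
    decide +revert
  rw [pairing_update, add_sub_cancel_left] at hparity
  have hsingle := abs_le.1 (hg.abs_single_le i a ha)
  have hsingle' := abs_le.1 (hg.abs_single_le i (-a) (by simpa using ha))
  have := hparity.trans hodd
  rw [Int.ModEq] at this
  omega

theorem exists_isTightBelow_update (hA : IsTightBelow g c A) {i : ι} (hc : c i = 0)
    {a : SignType} (ha : a ≠ 0) :
    ∃ A', IsTightBelow g (Function.update c i a) A' ∧ ∀ k ≠ i, vertex A' k = vertex A k := by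
  obtain ⟨b, hb, hab⟩ : ∃ b : SignType, b ≠ 0 ∧
      (a : ℤ) * b = g (Function.update c i a) - g c := by
    rcases hg.update_sub_eq_one_or hc ha with h | h <;> rw [h] <;> revert ha <;>
      clear h hc <;> revert a <;> decide
  obtain ⟨A', hA'⟩ := exists_vertex_eq (s := Function.update (vertex A) i b) fun k => by
    rcases eq_or_ne k i with rfl | hk <;> simp [vertex_ne_zero, *]
  have hoff : ∀ k ≠ i, vertex A' k = vertex A k := fun k hk => by simp [hA', hk]
  have hpairing : ∀ s : SignVec ι, s i = 0 → pairing s A' = pairing s A := fun s hs =>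
    pairing_congr fun k => by
      rcases eq_or_ne k i with rfl | hk
      exacts [Or.inl hs, Or.inr (hoff k hk)]
  have htop : ∀ s : SignVec ι, s i = 0 → pairing (Function.update s i a) A' =
      pairing s A + (g (Function.update c i a) - g c) := fun s hs => by
    simp [pairing_update, hpairing s hs, hs, hA', hab]
  refine ⟨A', ⟨fun s hs => ?_, ?_⟩, hoff⟩
  · have hlow := hA.pairing_le _ hs.update_zero
    rcases eq_or_ne (s i) 0 with hsi | hsi
    · rw [hpairing s hsi]
      rwa [← hsi, Function.update_eq_self] at hlow
    · have hbisub := hg.bisubmodular s c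
      have hs_top := htop (Function.update s i 0) (by simp)
      rw [hs.meet_eq hc hsi, hs.join_eq hc hsi] at hbisub
      rw [Function.update_idem, ← hs.apply_eq hsi, Function.update_eq_self,
        hs.apply_eq hsi] at hs_top
      linarith
  · rw [htop c hc, hA.pairing_eq, add_sub_cancel]

theorem exists_isTightBelow (hA : IsTightBelow g c A) (hcd : IsBelow c d) :
    ∃ A', IsTightBelow g d A' ∧ pairing c A' = g c := by
  suffices h : ∀ I : Finset ι, ∃ A', IsTightBelow g (I.piecewise d c) A' ∧ pairing c A' = g c by
    simpa using h Finset.univ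
  intro I
  induction I using Finset.induction_on with
  | empty => exact ⟨A, by simpa using hA, hA.pairing_eq⟩
  | insert i I hi ih =>
    obtain ⟨A', hA', hc⟩ := ih
    rw [Finset.piecewise_insert]
    have hci : I.piecewise d c i = c i := I.piecewise_eq_of_notMem d c hi
    rcases eq_or_ne (c i) (d i) with hcdi | hcdi
    · exact ⟨A', by rwa [← hcdi, ← hci, Function.update_eq_self], hc⟩
    · have hc0 : c i = 0 := (hcd i).resolve_right hcdi
      obtain ⟨A'', hA'', hoff⟩ :=
        hg.exists_isTightBelow_update hA' (hci.trans hc0) (hc0 ▸ hcdi).symm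
      refine ⟨A'', hA'', (pairing_congr fun k => ?_).trans hc⟩
      rcases eq_or_ne k i with rfl | hk
      exacts [Or.inl hc0, Or.inr (hoff k hk)]

theorem mem_feasibleVertices_of_isTightBelow (hA : IsTightBelow g d A) (hd : ∀ k, d k ≠ 0) :
    A ∈ feasibleVertices g := fun s => by
  have hmeet := hA.pairing_le _ (meet_isBelow_right s d)
  have hjoin := hA.pairing_le _ (join_isBelow_right s hd)
  have hsum := pairing_meet_add_pairing_join s d A
  have := hg.bisubmodular s d
  have := hA.pairing_eq
  linarith

theorem isSupportFunction_feasibleVertices : IsSupportFunction (feasibleVertices g) g := by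
  intro s
  have hzero : IsTightBelow g 0 ∅ :=
    ⟨fun s hs => by
      have : s = 0 := funext fun k => by simpa using hs k
      rw [this, pairing_zero, hg.zero], by rw [pairing_zero, hg.zero]⟩
  obtain ⟨A, hA, -⟩ := hg.exists_isTightBelow hzero (zero_isBelow s)
  obtain ⟨B, hB, hs⟩ := hg.exists_isTightBelow hA (d := fun k => if s k = 0 then 1 else s k)
    fun k => by by_cases hk : s k = 0 <;> simp [hk]
  refine ⟨⟨B, hg.mem_feasibleVertices_of_isTightBelow hB fun k => ?_, hs⟩, ?_⟩
  · by_cases hk : s k = 0 <;> simp [hk]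
  · rintro _ ⟨A, hA, rfl⟩
    exact hA s

end Greedy

section Exchange

variable (hg : IsRankFunction g) {A : Finset ι} {s t : SignVec ι} {i j : ι}
include hg

theorem even_slack (A : Finset ι) (s : SignVec ι) : Even (slack g A s) :=
  even_iff_two_dvd.2 (hg.modEq_pairing s A).symm.dvd

theorem slack_meet_add_slack_join_le (A : Finset ι) (s t : SignVec ι) :
    slack g A (meet s t) + slack g A (join s t) ≤ slack g A s + slack g A t := by
  have := hg.bisubmodular s t
  have := pairing_meet_add_pairing_join s t A
  unfold slack
  linarith

theorem slack_meet_eq_zero (hA : A ∈ feasibleVertices g) (hs : slack g A s = 0)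
    (ht : slack g A t = 0) : slack g A (meet s t) = 0 := by
  have := hg.slack_meet_add_slack_join_le A s t
  have := slack_nonneg hA (meet s t)
  have := slack_nonneg hA (join s t)
  omega

theorem exists_isLeastTightAgainst (hA : A ∈ feasibleVertices g) (ht : slack g A t = 0)
    (hti : t i = -vertex A i) : ∃ s, IsLeastTightAgainst g A i s := by
  obtain ⟨s, ⟨hs, hsi⟩, hmin⟩ := Set.Finite.exists_minimalFor Function.support
    {s : SignVec ι | slack g A s = 0 ∧ s i = -vertex A i} (Set.toFinite _) ⟨t, ht, hti⟩
  refine ⟨s, hs, hsi, fun t ht hti k => or_iff_not_imp_left.2 fun hk => ?_⟩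
  have hsub : Function.support (meet s t) ⊆ Function.support s := fun k hk h => hk (by
    simp [meet, show s k = 0 from h])
  have hmeet := hmin ⟨hg.slack_meet_eq_zero hA hs ht, by simp [meet, hsi, hti]⟩ hsub hk
  by_contra hne
  exact hmeet (if_neg hne)

theorem two_le_slack (hA : A ∈ feasibleVertices g) (ht : slack g A t ≠ 0) : 2 ≤ slack g A t := by
  obtain ⟨m, hm⟩ := hg.even_slack A t
  have := slack_nonneg hA t
  omega

theorem symmDiff_singleton_mem (hA : A ∈ feasibleVertices g)
    (hi : ∀ t, slack g A t = 0 → t i ≠ -vertex A i) : A ∆ {i} ∈ feasibleVertices g := fun t => by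
  rw [← sub_nonneg, ← slack, slack_symmDiff, Finset.sum_singleton]
  have := slack_nonneg hA t
  rcases apply_mul_vertex_cases t A i with ⟨hti, h⟩ | ⟨-, h⟩ | ⟨-, h⟩
  · have := hg.two_le_slack hA fun ht => hi t ht hti
    omega
  all_goals omega

theorem symmDiff_pair_mem (hA : A ∈ feasibleVertices g) (hs : IsLeastTightAgainst g A i s)
    (hj : s j = vertex A j) : A ∆ {i, j} ∈ feasibleVertices g := fun t => by
  have hne : i ≠ j := by
    rintro rfl
    exact vertex_ne_zero A i (SignType.self_eq_neg_iff.1 (hj.symm.trans hs.apply_eq))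
  have hslack : ∀ u : SignVec ι, u i = -vertex A i → u j ≠ vertex A j → 2 ≤ slack g A u :=
    fun u hui huj => hg.two_le_slack hA fun hu => by
      rcases hs.isBelow u hu hui j with h | h
      exacts [vertex_ne_zero A j (hj.symm.trans h), huj (h.symm.trans hj)]
  -- If the exchange lowers the slack of `t`, uncross `t` with `s`: whatever is opposite to `A` at
  -- `i` but does not agree with `A` at `j` is not above `s`, hence not tight.
  have hmeet (hti : t i = -vertex A i) (htj : t j = -vertex A j) : 2 ≤ slack g A (meet t s) :=
    hslack _ (by simp [meet, hti, hs.apply_eq])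
      (by simp [meet, htj, hj, vertex_ne_zero, (vertex_ne_zero A j).symm])
  have hjoin (hti : t i = -vertex A i ∨ t i = 0) (htj : t j = -vertex A j) :
      2 ≤ slack g A (join t s) :=
    hslack _ (by rcases hti with h | h <;> simp [join, h, hs.apply_eq])
      (by simp [join, htj, hj, vertex_ne_zero, (vertex_ne_zero A j).symm])
  have hsum := hg.slack_meet_add_slack_join_le A t s
  have ht_nonneg := slack_nonneg hA t
  have hmeet_nonneg := slack_nonneg hA (meet t s)
  rw [hs.slack_eq] at hsum
  rw [← sub_nonneg, ← slack, slack_symmDiff, Finset.sum_pair hne]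
  rcases apply_mul_vertex_cases t A j with ⟨htj, hq⟩ | ⟨htj, hq⟩ | ⟨-, hq⟩ <;>
    rcases apply_mul_vertex_cases t A i with ⟨hti, hp⟩ | ⟨hti, hp⟩ | ⟨-, hp⟩ <;> rw [hp, hq]
  · linarith [hmeet hti htj, hjoin (Or.inl hti) htj]
  · linarith [hjoin (Or.inr hti) htj]
  · linarith
  · linarith [hslack t hti (by rw [htj]; exact (vertex_ne_zero A j).symm)]
  all_goals linarith

theorem symmetricExchange_feasibleVertices : SymmetricExchange (feasibleVertices g) := by
  intro A hA B hB i hi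
  by_cases htight : ∃ t, slack g A t = 0 ∧ t i = -vertex A i
  · obtain ⟨t, ht, hti⟩ := htight
    obtain ⟨s, hs⟩ := hg.exists_isLeastTightAgainst hA ht hti
    obtain ⟨j, hj, hsj⟩ := exists_apply_eq_vertex hB hi hs.slack_eq hs.apply_eq
    exact ⟨j, hj, hg.symmDiff_pair_mem hA hs hsj⟩
  · push Not at htight
    exact ⟨i, hi, by simpa using hg.symmDiff_singleton_mem hA htight⟩

end Exchange

end IsRankFunction

end RankFunction

section Even

variable [DecidableEq ι] {F : Set (Finset ι)} {A B : Finset ι}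

theorem odd_sum_symmDiff {s : SignVec ι} {i : ι} (hsi : s i = 0) (hs : ∀ k ≠ i, s k ≠ 0)
    (hi : i ∈ A ∆ B) (heven : Even (A ∆ B).card) : Odd (∑ k ∈ A ∆ B, (s k : ℤ) * vertex A k) := by
  have hterm : ∑ k ∈ (A ∆ B).erase i, (s k : ℤ) * vertex A k ≡
      ∑ _k ∈ (A ∆ B).erase i, 1 [ZMOD 2] :=
    Int.ModEq.sum fun k hk => by
      have := hs k (Finset.ne_of_mem_erase hk)
      have := vertex_ne_zero A k
      generalize s k = a at *; generalize vertex A k = b at *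
      revert a b; decide
  obtain ⟨m, hm⟩ := heven
  have hpos := Finset.card_pos.2 ⟨i, hi⟩
  rw [Finset.sum_const, Finset.card_erase_of_mem hi, nsmul_one, Int.ModEq] at hterm
  rw [← Finset.add_sum_erase _ _ hi, hsi, SignType.coe_zero, zero_mul, zero_add, Int.odd_iff]
  omega

theorem SymmetricExchange.even_card_symmDiff (hF : SymmetricExchange F)
    (hodd : ∀ A ∈ F, ∀ i, A ∆ {i} ∉ F) (hA : A ∈ F) (hB : B ∈ F) : Even (A ∆ B).card := by
  induction h : A ∆ B using Finset.strongInduction generalizing B with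
  | H M ih =>
    subst h
    rcases (A ∆ B).eq_empty_or_nonempty with hempty | ⟨i, hi⟩
    · simp [hempty]
    · obtain ⟨j, hj, hij⟩ := hF B hB A hA i (symmDiff_comm A B ▸ hi)
      rw [symmDiff_comm] at hj
      have hne : i ≠ j := by
        rintro rfl
        rw [Finset.pair_eq_singleton] at hij
        exact hodd B hB i hij
      have hsub : {i, j} ⊆ A ∆ B := Finset.insert_subset hi (Finset.singleton_subset_iff.2 hj)
      have heven := ih _ (symmDiff_symmDiff_ssubset (Finset.insert_nonempty i {j}) hsub) hij rfl
      rw [← symmDiff_assoc, symmDiff_of_ge hsub] at heven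
      rw [← Finset.card_sdiff_add_card_eq_card hsub, Finset.card_pair hne]
      exact heven.add even_two

variable [Fintype ι] {g : SignVec ι → ℤ}

theorem isEdgePair_symmDiff_singleton {i : ι} (hA : A ∈ F) (hAi : A ∆ {i} ∈ F) :
    IsEdgePair F A (A ∆ {i}) := by
  obtain ⟨C, hC, hiC, hsub⟩ := exists_isEdgePair (i := i) hA hAi (by simp)
  rw [symmDiff_symmDiff_cancel_left] at hsub
  rw [← hsub.antisymm (Finset.singleton_subset_iff.2 hiC), symmDiff_symmDiff_cancel_left]
  exact hC

theorem SymmetricExchange.forall_isEdgePair_card_eq_two_iff (hF : SymmetricExchange F) :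
    (∀ A B, IsEdgePair F A B → (A ∆ B).card = 2) ↔ ∀ A ∈ F, ∀ i, A ∆ {i} ∉ F := by
  refine ⟨fun h A hA i hAi => ?_, fun h A B hAB => ?_⟩
  · have := h _ _ (isEdgePair_symmDiff_singleton hA hAi)
    simp at this
  · have hle := hF.card_symmDiff_le_two hAB
    have hpos : (A ∆ B).card ≠ 0 := by simpa using hAB.ne
    have hone : (A ∆ B).card ≠ 1 := fun hcard => by
      obtain ⟨i, hi⟩ := Finset.card_eq_one.1 hcard
      refine h A hAB.mem.1 i ?_
      rw [← hi, symmDiff_symmDiff_cancel_left]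
      exact hAB.mem.2
    omega

theorem pairing_le_of_isBelow_vertex {s : SignVec ι} (hs : IsBelow s (vertex A)) (B : Finset ι) :
    pairing s B ≤ pairing s A :=
  Finset.sum_le_sum fun k _ => by
    have := hs k
    have := vertex_ne_zero A k
    beta_reduce
    generalize s k = a at *; generalize vertex A k = b at *; generalize vertex B k = c
    clear hs
    revert a b c; decide

theorem IsSupportFunction.two_mul_lt_update_add_update (hg : IsSupportFunction F g) {i : ι}
    (hA : A ∈ F) (hAi : A ∆ {i} ∈ F) {s : SignVec ι} (hsi : s i = 0)
    (hs : IsBelow s (vertex A)) :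
    2 * g s < g (Function.update s i 1) + g (Function.update s i (-1)) := by
  have hgs : g s ≤ pairing s A := by
    obtain ⟨B, -, hB⟩ := (hg s).1
    exact hB ▸ pairing_le_of_isBelow_vertex hs B
  have hself (a : SignType) : pairing s A + a * vertex A i ≤ g (Function.update s i a) := by
    simpa [pairing_update, hsi] using hg.pairing_le (Function.update s i a) hA
  have hflip (a : SignType) : pairing s A - a * vertex A i ≤ g (Function.update s i a) := by
    have hAflip : pairing s (A ∆ {i}) = pairing s A := by simp [pairing_symmDiff, hsi]
    simpa [pairing_update, hAflip, vertex_symmDiff, hsi, sub_eq_add_neg] using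
      hg.pairing_le (Function.update s i a) hAi
  have hplus : pairing s A + 1 ≤ g (Function.update s i 1) := by
    by_cases hiA : i ∈ A
    exacts [by simpa [vertex, hiA] using hself 1, by simpa [vertex, hiA] using hflip 1]
  have hminus : pairing s A + 1 ≤ g (Function.update s i (-1)) := by
    by_cases hiA : i ∈ A
    exacts [by simpa [vertex, hiA] using hflip (-1), by simpa [vertex, hiA] using hself (-1)]
  linarith

theorem IsSupportFunction.update_add_update_le (hg : IsSupportFunction F g)
    (heven : ∀ A ∈ F, ∀ B ∈ F, Even (A ∆ B).card) {s : SignVec ι} {i : ι} (hsi : s i = 0)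
    (hs : ∀ k ≠ i, s k ≠ 0) :
    g (Function.update s i 1) + g (Function.update s i (-1)) ≤ 2 * g s := by
  by_contra! hlt
  obtain ⟨A, hA, hgA⟩ := (hg (Function.update s i 1)).1
  obtain ⟨B, hB, hgB⟩ := (hg (Function.update s i (-1))).1
  have hsA := hg.pairing_le s hA
  have hsB := hg.pairing_le s hB
  have hAB : pairing s B = pairing s A - 2 * ∑ k ∈ A ∆ B, (s k : ℤ) * vertex A k := by
    rw [← pairing_symmDiff, symmDiff_symmDiff_cancel_left]
  rw [pairing_update, hsi] at hgA hgB
  simp only [SignType.coe_one, SignType.coe_neg, SignType.coe_zero, sub_zero, one_mul,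
    neg_mul] at hgA hgB
  have hi : i ∈ A ∆ B := by
    by_contra hi
    rw [notMem_symmDiff_iff_vertex.1 hi] at hgB
    linarith
  have hiA : (vertex A i : ℤ) ≤ 1 := by
    by_cases hiA : i ∈ A <;> simp [vertex, hiA]
  obtain ⟨m, hm⟩ := odd_sum_symmDiff hsi hs hi (heven A hA B hB)
  rw [mem_symmDiff_iff_vertex.1 hi, SignType.coe_neg] at hgB
  omega

theorem IsSupportFunction.two_mul_le_update_add_update (hg : IsSupportFunction F g)
    {s : SignVec ι} {i : ι} (hsi : s i = 0) :
    2 * g s ≤ g (Function.update s i 1) + g (Function.update s i (-1)) := by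
  obtain ⟨A, hA, hgA⟩ := (hg s).1
  have hplus : g s + vertex A i ≤ g (Function.update s i 1) := by
    simpa [pairing_update, hsi, hgA] using hg.pairing_le (Function.update s i 1) hA
  have hminus : g s - vertex A i ≤ g (Function.update s i (-1)) := by
    simpa [pairing_update, hsi, hgA, sub_eq_add_neg] using
      hg.pairing_le (Function.update s i (-1)) hA
  linarith

theorem IsSupportFunction.forall_isEdgePair_card_eq_two_iff (hg : IsSupportFunction F g)
    (hF : SymmetricExchange F) :
    (∀ A B, IsEdgePair F A B → (A ∆ B).card = 2) ↔ ∀ (s : SignVec ι) (i : ι), s i = 0 →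
      (∀ k ≠ i, s k ≠ 0) →
        g (Function.update s i 1) + g (Function.update s i (-1)) = 2 * g s := by
  rw [hF.forall_isEdgePair_card_eq_two_iff]
  refine ⟨fun hodd s i hsi hs => ?_, fun h A hA i hAi => ?_⟩
  · have heven : ∀ A ∈ F, ∀ B ∈ F, Even (A ∆ B).card := fun A hA B hB =>
      hF.even_card_symmDiff hodd hA hB
    exact (hg.update_add_update_le heven hsi hs).antisymm (hg.two_mul_le_update_add_update hsi)
  · have hbelow : IsBelow (Function.update (vertex A) i 0) (vertex A) := fun k => by
      rcases eq_or_ne k i with rfl | hk <;> simp [*]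
    refine (hg.two_mul_lt_update_add_update hA hAi (by simp) hbelow).ne' (h _ i (by simp) ?_)
    exact fun k hk => by simp [hk, vertex_ne_zero]

end Even

end SignVec

section Polytope

variable {E : Type*} [AddCommGroup E] [Module ℝ E] [TopologicalSpace E] {V Q : Set E}

theorem inter_toExposed_convexHull (l : E →L[ℝ] ℝ) (V : Set E) :
    V ∩ l.toExposed (convexHull ℝ V) = {p ∈ V | ∀ q ∈ V, l q ≤ l p} := by
  ext p
  refine and_congr_right fun hp => ⟨fun h q hq => h.2 q (subset_convexHull ℝ V hq), fun h => ?_⟩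
  exact ⟨subset_convexHull ℝ V hp,
    convexHull_min h (convex_halfSpace_le l.toLinearMap.isLinear (l p))⟩

variable [T2Space E] [IsTopologicalAddGroup E] [ContinuousSMul ℝ E] [LocallyConvexSpace ℝ E]

-- A face is the closed convex hull of its extreme points, which are extreme points of the polytope.
theorem subset_convexHull_inter_of_isExposed (hV : V.Finite) (hQ : IsExposed ℝ (convexHull ℝ V) Q) :
    Q ⊆ convexHull ℝ (V ∩ Q) := by
  have hextreme : Q.extremePoints ℝ ⊆ V ∩ Q := fun p hp =>
    ⟨extremePoints_convexHull_subset (hQ.isExtreme.extremePoints_subset_extremePoints hp), hp.1⟩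
  calc Q = closure (convexHull ℝ (Q.extremePoints ℝ)) :=
        (closure_convexHull_extremePoints (hQ.isCompact (hV.isCompact_convexHull ℝ))
          (hQ.convex (convex_convexHull ℝ V))).symm
    _ ⊆ convexHull ℝ (V ∩ Q) :=
        ((hV.inter_of_left Q).isClosed_convexHull ℝ).closure_subset_iff.2
          (convexHull_mono hextreme)

theorem vectorSpan_eq_vectorSpan_inter_of_isExposed (hV : V.Finite)
    (hQ : IsExposed ℝ (convexHull ℝ V) Q) : vectorSpan ℝ Q = vectorSpan ℝ (V ∩ Q) := by
  refine le_antisymm ?_ (vectorSpan_mono ℝ Set.inter_subset_right)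
  calc vectorSpan ℝ Q ≤ vectorSpan ℝ (convexHull ℝ (V ∩ Q)) :=
        vectorSpan_mono ℝ (subset_convexHull_inter_of_isExposed hV hQ)
    _ = vectorSpan ℝ (V ∩ Q) := by
        rw [← direction_affineSpan, affineSpan_convexHull, direction_affineSpan]

end Polytope

namespace SignVec

section RealVertex

variable {ι : Type*} [DecidableEq ι] {A B C : Finset ι}

/-- The vertex `A` of the cube `[-1, 1]^ι` as a point of `ℝ^ι`. -/
def realVertex (A : Finset ι) : ι → ℝ := fun i => (vertex A i : ℝ)

theorem realVertex_apply_cases (A : Finset ι) (i : ι) :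
    realVertex A i = 1 ∨ realVertex A i = -1 := by
  by_cases hi : i ∈ A <;> simp [realVertex, vertex, hi]

theorem realVertex_sub_apply (A B : Finset ι) (i : ι) :
    (realVertex B - realVertex A) i = if i ∈ A ∆ B then 2 * realVertex B i else 0 := by
  by_cases hA : i ∈ A <;> by_cases hB : i ∈ B <;>
    norm_num [realVertex, vertex, Finset.mem_symmDiff, hA, hB]

theorem realVertex_sub_apply_ne_zero_iff {i : ι} :
    (realVertex B - realVertex A) i ≠ 0 ↔ i ∈ A ∆ B := by
  rw [realVertex_sub_apply]
  rcases realVertex_apply_cases B i with h | h <;> simp [h]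

theorem realVertex_injective : Function.Injective (realVertex : Finset ι → ι → ℝ) :=
  fun A B h => symmDiff_eq_bot.1 <| Finset.eq_empty_of_forall_notMem fun i hi =>
    realVertex_sub_apply_ne_zero_iff.2 hi (by simp [h])

theorem eq_or_eq_of_realVertex_sub_eq_smul (hAB : A ≠ B) {c : ℝ}
    (hc : c • (realVertex B - realVertex A) = realVertex C - realVertex A) : C = A ∨ C = B := by
  obtain ⟨k, hk⟩ := Finset.symmDiff_nonempty.2 hAB
  have hck : c * (realVertex B - realVertex A) k = (realVertex C - realVertex A) k := congrFun hc k
  rw [realVertex_sub_apply, if_pos hk, realVertex_sub_apply] at hck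
  have hkB : realVertex B k ≠ 0 := by
    rcases realVertex_apply_cases B k with h | h <;> simp [h]
  rcases eq_or_ne c 0 with rfl | hc0
  · rw [zero_smul] at hc
    exact Or.inl (realVertex_injective (sub_eq_zero.1 hc.symm))
  · have hkC : k ∈ A ∆ C := by
      by_contra hkC
      rw [if_neg hkC] at hck
      simp [hc0, hkB] at hck
    have hBC : realVertex C k = realVertex B k := by
      simp only [realVertex, mem_symmDiff_iff_vertex.1 hk, mem_symmDiff_iff_vertex.1 hkC]
    rw [if_pos hkC, hBC, mul_eq_right₀ (mul_ne_zero two_ne_zero hkB)] at hck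
    rw [hck, one_smul] at hc
    exact Or.inr (realVertex_injective (sub_left_inj.1 hc.symm))

theorem symmDiff_eq_of_span_eq [Fintype ι] {v : ι → ℝ}
    (h : Submodule.span ℝ {realVertex B - realVertex A} = Submodule.span ℝ {v}) :
    A ∆ B = Finset.univ.filter (v · ≠ 0) := by
  obtain ⟨z, rfl⟩ := Submodule.span_singleton_eq_span_singleton.1 h
  ext k
  rw [← realVertex_sub_apply_ne_zero_iff]
  simp [Units.smul_def]

theorem realVertex_sub_of_symmDiff_eq_singleton {i : ι} (h : A ∆ B = {i}) :
    realVertex B - realVertex A = (2 * realVertex B i) • Pi.single i 1 := by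
  funext k
  rw [realVertex_sub_apply, h]
  rcases eq_or_ne k i with rfl | hk <;> simp [*]

theorem realVertex_sub_of_symmDiff_eq_pair {i j : ι} (hij : i ≠ j) (h : A ∆ B = {i, j}) :
    realVertex B - realVertex A = (2 * realVertex B i) • Pi.single i 1 +
      (2 * realVertex B j) • Pi.single j 1 := by
  funext k
  rw [realVertex_sub_apply, h]
  rcases eq_or_ne k i with rfl | hki
  · simp [hij]
  · rcases eq_or_ne k j with rfl | hkj <;> simp [*]

theorem isUnit_two_mul_realVertex (A : Finset ι) (i : ι) : IsUnit (2 * realVertex A i) := by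
  rcases realVertex_apply_cases A i with h | h <;> simp [h]

end RealVertex

section Edge

variable {n : ℕ} {F : Set (Finset (Fin n))} {A B : Finset (Fin n)} {Q : Set (Fin n → ℝ)}

theorem exists_isParallelTo_single_iff
    (hQ : vectorSpan ℝ Q = Submodule.span ℝ {realVertex B - realVertex A}) :
    (∃ i, IsParallelTo Q (Pi.single i 1)) ↔ (A ∆ B).card = 1 := by
  rw [Finset.card_eq_one]
  refine exists_congr fun i => ⟨fun h => ?_, fun h => ?_⟩
  · rw [symmDiff_eq_of_span_eq (hQ.symm.trans h)]
    ext k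
    simp [Pi.single_apply]
  · rw [IsParallelTo, hQ, realVertex_sub_of_symmDiff_eq_singleton h,
      Submodule.span_singleton_smul_eq (isUnit_two_mul_realVertex B i)]

theorem isParallelToPair_iff
    (hQ : vectorSpan ℝ Q = Submodule.span ℝ {realVertex B - realVertex A}) :
    IsParallelToPair Q ↔ (A ∆ B).card = 2 := by
  rw [Finset.card_eq_two]
  refine exists₂_congr fun i j => and_congr_right fun hij => ⟨fun h => ?_, fun h => ?_⟩
  · rcases h with h | h <;>
    · rw [symmDiff_eq_of_span_eq (hQ.symm.trans h)]
      ext k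
      rcases eq_or_ne k i with rfl | hki
      · simp [hij]
      · rcases eq_or_ne k j with rfl | hkj <;> simp [*]
  · have hsub := realVertex_sub_of_symmDiff_eq_pair hij h
    have hunit := isUnit_two_mul_realVertex B i
    have hsign : realVertex B j = realVertex B i ∨ realVertex B j = -realVertex B i := by
      rcases realVertex_apply_cases B i with hi | hi <;>
        rcases realVertex_apply_cases B j with hj | hj <;> simp [hi, hj]
    rw [IsParallelTo, IsParallelTo, hQ, hsub]
    refine hsign.imp (fun hj => ?_) fun hj => ?_
    · rw [hj, ← smul_add, Submodule.span_singleton_smul_eq hunit]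
    · rw [hj, mul_neg, neg_smul, ← sub_eq_add_neg, ← smul_sub,
        Submodule.span_singleton_smul_eq hunit]

theorem weight_apply_single (l : (Fin n → ℝ) →ₗ[ℝ] ℝ) (A : Finset (Fin n)) :
    weight (fun k => l (Pi.single k 1)) A = l (realVertex A) := by
  rw [pi_eq_sum_univ' (realVertex A), map_sum]
  simp [weight, realVertex, mul_comm]

theorem image_realVertex_inter_toExposed {l : (Fin n → ℝ) →L[ℝ] ℝ} {w : Fin n → ℝ}
    (hl : ∀ A, l (realVertex A) = weight w A) (F : Set (Finset (Fin n))) :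
    realVertex '' F ∩ l.toExposed (convexHull ℝ (realVertex '' F)) =
      realVertex '' {C ∈ F | ∀ D ∈ F, weight w D ≤ weight w C} := by
  rw [inter_toExposed_convexHull]
  ext p
  constructor
  · rintro ⟨⟨C, hC, rfl⟩, hmax⟩
    exact ⟨C, ⟨hC, fun D hD => by simpa only [hl] using hmax _ ⟨D, hD, rfl⟩⟩, rfl⟩
  · rintro ⟨C, ⟨hC, hmax⟩, rfl⟩
    exact ⟨⟨C, hC, rfl⟩, by simpa [hl] using hmax⟩

theorem IsEdgePair.exists_isEdge (h : IsEdgePair F A B) :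
    ∃ Q, IsEdge (convexHull ℝ (realVertex '' F)) Q ∧
      vectorSpan ℝ Q = Submodule.span ℝ {realVertex B - realVertex A} := by
  obtain ⟨w, hw⟩ := h.exists_weight
  let l : (Fin n → ℝ) →L[ℝ] ℝ := ∑ k, w k • ContinuousLinearMap.proj k
  have hl (C : Finset (Fin n)) : l (realVertex C) = weight w C := by
    simp [l, realVertex, weight]
  have hexposed : IsExposed ℝ (convexHull ℝ (realVertex '' F)) _ :=
    ContinuousLinearMap.toExposed.isExposed (l := l)
  have hspan : vectorSpan ℝ (l.toExposed (convexHull ℝ (realVertex '' F))) =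
      Submodule.span ℝ {realVertex B - realVertex A} := by
    rw [vectorSpan_eq_vectorSpan_inter_of_isExposed (Set.toFinite _) hexposed,
      image_realVertex_inter_toExposed hl, hw, Set.image_pair, vectorSpan_pair_rev, vsub_eq_sub]
  refine ⟨_, ⟨hexposed, ?_⟩, hspan⟩
  rw [hspan, finrank_span_singleton (sub_ne_zero.2 (realVertex_injective.ne h.ne.symm))]

theorem exists_isEdgePair_of_isEdge (hQ : IsEdge (convexHull ℝ (realVertex '' F)) Q) :
    ∃ A B, IsEdgePair F A B ∧
      vectorSpan ℝ Q = Submodule.span ℝ {realVertex B - realVertex A} := by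
  obtain ⟨hexposed, hrank⟩ := hQ
  have hnontrivial : (realVertex '' F ∩ Q).Nontrivial := by
    by_contra h
    rw [vectorSpan_eq_vectorSpan_inter_of_isExposed (Set.toFinite _) hexposed,
      vectorSpan_of_subsingleton ℝ (Set.not_nontrivial_iff.1 h)] at hrank
    simp at hrank
  obtain ⟨_, ⟨⟨A, hA, rfl⟩, hAQ⟩, _, ⟨⟨B, hB, rfl⟩, hBQ⟩, hne⟩ := hnontrivial
  have hspan : vectorSpan ℝ Q = Submodule.span ℝ {realVertex B - realVertex A} := by
    refine (Submodule.eq_of_le_of_finrank_eq ?_ ?_).symm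
    · exact (Submodule.span_singleton_le_iff_mem _ _).2 (vsub_mem_vectorSpan ℝ hBQ hAQ)
    · rw [hrank, finrank_span_singleton (sub_ne_zero.2 hne.symm)]
  have hAB : A ≠ B := fun h => hne (h ▸ rfl)
  have hmem : ∀ C, realVertex C ∈ Q → C = A ∨ C = B := fun C hCQ => by
    have hC : realVertex C - realVertex A ∈ vectorSpan ℝ Q := vsub_mem_vectorSpan ℝ hCQ hAQ
    rw [hspan] at hC
    obtain ⟨c, hc⟩ := Submodule.mem_span_singleton.1 hC
    exact eq_or_eq_of_realVertex_sub_eq_smul hAB hc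
  obtain ⟨l, hl⟩ := hexposed ⟨_, hAQ⟩
  have hface := image_realVertex_inter_toExposed (l := l)
    (fun C => (weight_apply_single l.toLinearMap C).symm) F
  refine ⟨A, B, ⟨hAB, _, realVertex_injective.image_injective (hface.symm.trans ?_)⟩, hspan⟩
  change realVertex '' F ∩ {x ∈ _ | _} = _
  rw [← hl]
  ext p
  constructor
  · rintro ⟨⟨C, -, rfl⟩, hCQ⟩
    exact Set.mem_image_of_mem _ (hmem C hCQ)
  · rintro ⟨C, rfl | rfl, rfl⟩
    exacts [⟨⟨_, hA, rfl⟩, hAQ⟩, ⟨⟨_, hB, rfl⟩, hBQ⟩]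

end Edge

end SignVec

namespace AdS

open SignVec

variable {n : ℕ}

/-- The encoding of admissible sets by sign vectors. -/
def signVec : AdS n ≃ SignVec (Fin n) where
  toFun S i := if Sum.inl i ∈ S.1 then 1 else if Sum.inr i ∈ S.1 then -1 else 0
  invFun s := ⟨Finset.univ.filter fun a => Sum.elim s (-s) a = 1, fun i h => by
    have hpos : s i = 1 := (Finset.mem_filter.1 h.1).2
    have hneg : -s i = 1 := (Finset.mem_filter.1 h.2).2
    rw [hpos] at hneg
    exact absurd hneg (by decide)⟩
  left_inv S := by
    refine Subtype.ext (Finset.ext fun a => ?_)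
    rcases a with i | i
    · by_cases hl : Sum.inl i ∈ S.1 <;> by_cases hr : Sum.inr i ∈ S.1 <;> simp [hl, hr]
    · have := S.2 i
      by_cases hl : Sum.inl i ∈ S.1 <;> by_cases hr : Sum.inr i ∈ S.1 <;> simp_all
  right_inv s := by
    funext i
    simp only [Finset.mem_filter, Finset.mem_univ, true_and, Sum.elim_inl, Sum.elim_inr,
      Pi.neg_apply]
    generalize s i = a
    decide +revert

theorem inl_mem_iff (S : AdS n) (i : Fin n) : Sum.inl i ∈ S.1 ↔ signVec S i = 1 := by
  by_cases hl : Sum.inl i ∈ S.1 <;> by_cases hr : Sum.inr i ∈ S.1 <;> simp [signVec, hl, hr]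

theorem inr_mem_iff (S : AdS n) (i : Fin n) : Sum.inr i ∈ S.1 ↔ signVec S i = -1 := by
  have := S.2 i
  by_cases hl : Sum.inl i ∈ S.1 <;> by_cases hr : Sum.inr i ∈ S.1 <;> simp_all [signVec]

theorem signVec_eq_iff {S : AdS n} {s : SignVec (Fin n)} : signVec S = s ↔
    (∀ i, Sum.inl i ∈ S.1 ↔ s i = 1) ∧ ∀ i, Sum.inr i ∈ S.1 ↔ s i = -1 := by
  simp only [inl_mem_iff, inr_mem_iff, ← forall_and, funext_iff]
  refine forall_congr' fun i => ?_
  generalize signVec S i = a; generalize s i = b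
  decide +revert

theorem signVec_apply_eq_zero_iff {S : AdS n} {i : Fin n} :
    signVec S i = 0 ↔ Sum.inl i ∉ S.1 ∧ Sum.inr i ∉ S.1 := by
  rw [inl_mem_iff, inr_mem_iff]
  generalize signVec S i = a
  decide +revert

theorem signVec_empty : signVec (empty n) = 0 := by
  simp [signVec_eq_iff, empty]

theorem signVec_inter (S T : AdS n) : signVec (S.inter T) = meet (signVec S) (signVec T) := by
  simp only [signVec_eq_iff, ← forall_and, inter, Finset.mem_inter, inl_mem_iff, inr_mem_iff, meet]
  intro i
  generalize signVec S i = a; generalize signVec T i = b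
  decide +revert

theorem signVec_sqUnion (S T : AdS n) : signVec (S.sqUnion T) = join (signVec S) (signVec T) := by
  simp only [signVec_eq_iff, ← forall_and, sqUnion, Finset.mem_filter, Finset.mem_union,
    Sum.swap_inl, Sum.swap_inr, inl_mem_iff, inr_mem_iff, join]
  intro i
  generalize signVec S i = a; generalize signVec T i = b
  decide +revert

theorem signVec_adjoin_inl (S : AdS n) (i : Fin n) (h : Sum.inr i ∉ S.1) :
    signVec (S.adjoin (Sum.inl i) h) = Function.update (signVec S) i 1 := by
  simp only [signVec_eq_iff, ← forall_and, adjoin, Finset.mem_insert]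
  intro k
  rcases eq_or_ne k i with rfl | hk
  · simpa using h
  · simp [hk, inl_mem_iff, inr_mem_iff]

theorem signVec_adjoin_inr (S : AdS n) (i : Fin n) (h : Sum.inl i ∉ S.1) :
    signVec (S.adjoin (Sum.inr i) h) = Function.update (signVec S) i (-1) := by
  simp only [signVec_eq_iff, ← forall_and, adjoin, Finset.mem_insert]
  intro k
  rcases eq_or_ne k i with rfl | hk
  · simpa using h
  · simp [hk, inl_mem_iff, inr_mem_iff]

theorem cast_card_eq_sum (A : Finset (SignedGround n)) : (A.card : ℤ) =
    ∑ i, ((if Sum.inl i ∈ A then 1 else 0) + if Sum.inr i ∈ A then 1 else 0) := by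
  rw [Finset.sum_add_distrib, ← Fintype.sum_sum_type fun a => if a ∈ A then (1 : ℤ) else 0]
  simp

theorem card_eq_card_support (S : AdS n) :
    S.1.card = (Finset.univ.filter (signVec S · ≠ 0)).card := by
  rw [← Nat.cast_inj (R := ℤ), cast_card_eq_sum, Finset.card_filter, Nat.cast_sum]
  refine Finset.sum_congr rfl fun i _ => ?_
  simp only [inl_mem_iff, inr_mem_iff]
  generalize signVec S i = a
  decide +revert

theorem card_eq_iff (S : AdS n) : S.1.card = n ↔ ∀ i, signVec S i ≠ 0 := by
  conv_lhs => rhs; rw [← Finset.card_fin n]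
  rw [card_eq_card_support, Finset.card_filter_eq_iff]
  simp

theorem card_add_one_eq_iff {S : AdS n} {i : Fin n} (hi : signVec S i = 0) :
    S.1.card + 1 = n ↔ ∀ k ≠ i, signVec S k ≠ 0 := by
  have hsub : Finset.univ.filter (signVec S · ≠ 0) ⊆ Finset.univ.erase i := fun k hk =>
    Finset.mem_erase.2 ⟨fun h => (Finset.mem_filter.1 hk).2 (h ▸ hi), Finset.mem_univ k⟩
  have hn : (Finset.univ.erase i).card + 1 = n := by
    rw [Finset.card_erase_add_one (Finset.mem_univ i), Finset.card_fin]
  calc S.1.card + 1 = n ↔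
      (Finset.univ.erase i).card ≤ (Finset.univ.filter (signVec S · ≠ 0)).card := by
        have hle := Finset.card_le_card hsub
        rw [card_eq_card_support]
        omega
    _ ↔ Finset.univ.erase i ⊆ Finset.univ.filter (signVec S · ≠ 0) :=
        ⟨fun h => (Finset.eq_of_subset_of_card_le hsub h).ge, Finset.card_le_card⟩
    _ ↔ ∀ k ≠ i, signVec S k ≠ 0 := by simp [Finset.subset_iff]

theorem card_eq_one_iff (S : AdS n) :
    S.1.card = 1 ↔ ∃ i a, a ≠ 0 ∧ signVec S = Pi.single i a := by
  rw [card_eq_card_support, Finset.card_eq_one]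
  refine exists_congr fun i => ⟨fun h => ?_, ?_⟩
  · have hsupport (k : Fin n) : signVec S k ≠ 0 ↔ k = i := by simpa using Finset.ext_iff.1 h k
    refine ⟨signVec S i, (hsupport i).2 rfl, funext fun k => ?_⟩
    rcases eq_or_ne k i with rfl | hk
    · simp
    · simpa [hk] using (hsupport k).not.2 hk
  · rintro ⟨a, ha, h⟩
    ext k
    simp [h, Pi.single_apply, ha]

theorem card_modEq (S : AdS n) : (S.1.card : ℤ) ≡ ∑ i, (signVec S i : ℤ) [ZMOD 2] := by
  rw [cast_card_eq_sum]
  refine Int.ModEq.sum fun i _ => ?_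
  simp only [inl_mem_iff, inr_mem_iff]
  generalize signVec S i = a
  decide +revert

theorem card_inter_sub_card_bar_inter (S : AdS n) (A : Finset (Fin n)) :
    ((S.1 ∩ (signVec.symm (vertex A)).1).card : ℤ) - (S.bar ∩ (signVec.symm (vertex A)).1).card =
      pairing (signVec S) A := by
  rw [cast_card_eq_sum, cast_card_eq_sum, ← Finset.sum_sub_distrib, pairing, weight]
  refine Finset.sum_congr rfl fun i _ => ?_
  have hinl : Sum.inl i ∈ S.bar ↔ Sum.inr i ∈ S.1 := by simp [bar]
  have hinr : Sum.inr i ∈ S.bar ↔ Sum.inl i ∈ S.1 := by simp [bar]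
  simp only [Finset.mem_inter, hinl, hinr, inl_mem_iff, inr_mem_iff, Equiv.apply_symm_apply]
  generalize signVec S i = a; generalize vertex A i = b
  decide +revert

theorem vec_apply (S : AdS n) (i : Fin n) : S.vec i = signVec S i := by
  have hsum : ∑ a ∈ S.1, elemVec a i = ∑ a, if a ∈ S.1 then elemVec a i else 0 := by simp
  rw [vec, Finset.sum_apply, hsum, Fintype.sum_sum_type,
    Finset.sum_eq_single i (by simp +contextual [elemVec, eq_comm]) (by simp),
    Finset.sum_eq_single i (by simp +contextual [elemVec, eq_comm]) (by simp)]
  simp only [elemVec, inl_mem_iff, inr_mem_iff]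
  generalize signVec S i = a
  cases a <;> simp

theorem card_signVec_symm_vertex (A : Finset (Fin n)) : (signVec.symm (vertex A)).1.card = n := by
  simp [card_eq_iff, vertex_ne_zero]

theorem exists_signVec_symm_vertex_eq {B : AdS n} (hB : B.1.card = n) :
    ∃ A, signVec.symm (vertex A) = B := by
  obtain ⟨A, hA⟩ := exists_vertex_eq ((card_eq_iff B).1 hB)
  exact ⟨A, by rw [hA, Equiv.symm_apply_apply]⟩

theorem isRankFunction_comp_signVec_symm_iff {g : AdS n → ℤ} :
    IsRankFunction (fun s => g (signVec.symm s)) ↔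
      g (empty n) = 0 ∧ (∀ S : AdS n, S.1.card = 1 → |g S| ≤ 1) ∧ IsBisubmodular g ∧
        ∀ S : AdS n, g S ≡ (S.1.card : ℤ) [ZMOD 2] := by
  have hempty : signVec.symm (0 : SignVec (Fin n)) = empty n :=
    signVec.symm_apply_eq.2 signVec_empty.symm
  have hmeet (S T : AdS n) : signVec.symm (meet (signVec S) (signVec T)) = S.inter T :=
    signVec.symm_apply_eq.2 (signVec_inter S T).symm
  have hjoin (S T : AdS n) : signVec.symm (join (signVec S) (signVec T)) = S.sqUnion T :=
    signVec.symm_apply_eq.2 (signVec_sqUnion S T).symm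
  refine ⟨fun h => ⟨hempty ▸ h.zero, fun S hS => ?_, fun S T => ?_, fun S => ?_⟩, ?_⟩
  · obtain ⟨i, a, ha, hSi⟩ := (card_eq_one_iff S).1 hS
    simpa only [← hSi, Equiv.symm_apply_apply] using h.abs_single_le i a ha
  · simpa only [hmeet, hjoin, Equiv.symm_apply_apply] using
      h.bisubmodular (signVec S) (signVec T)
  · simpa only [Equiv.symm_apply_apply] using (h.modEq (signVec S)).trans (card_modEq S).symm
  · rintro ⟨hzero, hsingle, hbisub, hmod⟩
    refine ⟨by rwa [hempty], fun i a ha => hsingle _ ?_, fun s t => ?_, fun s => ?_⟩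
    · exact (card_eq_one_iff _).2 ⟨i, a, ha, signVec.apply_symm_apply _⟩
    · simpa only [← hmeet, ← hjoin, Equiv.apply_symm_apply] using
        hbisub (signVec.symm s) (signVec.symm t)
    · simpa only [Equiv.apply_symm_apply] using
        (hmod (signVec.symm s)).trans (card_modEq (signVec.symm s))

/-- The sets of unbarred elements of the members of size `n` of a collection of admissible sets.
A member of size `n` is determined by its unbarred elements. -/
def positiveParts (𝓕 : Finset (AdS n)) : Set (Finset (Fin n)) :=
  {A | signVec.symm (vertex A) ∈ 𝓕}

theorem feasiblePolytope_eq_convexHull {𝓕 : Finset (AdS n)} (h𝓕 : ∀ B ∈ 𝓕, B.1.card = n) :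
    feasiblePolytope 𝓕 = convexHull ℝ (realVertex '' positiveParts 𝓕) := by
  have hvec (A : Finset (Fin n)) : (signVec.symm (vertex A)).vec = realVertex A := by
    funext i
    rw [vec_apply, Equiv.apply_symm_apply, realVertex]
  rw [feasiblePolytope]
  congr 1
  ext p
  constructor
  · rintro ⟨B, hB, rfl⟩
    obtain ⟨A, rfl⟩ := exists_signVec_symm_vertex_eq (h𝓕 B hB)
    exact ⟨A, hB, (hvec A).symm⟩
  · rintro ⟨A, hA, rfl⟩
    exact ⟨_, hA, hvec A⟩

theorem forall_isEdge_isParallelTo_iff {𝓕 : Finset (AdS n)} (h𝓕 : ∀ B ∈ 𝓕, B.1.card = n) :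
    (∀ Q, IsEdge (feasiblePolytope 𝓕) Q →
      (∃ i : Fin n, IsParallelTo Q (Pi.single i 1)) ∨ IsParallelToPair Q) ↔
        SymmetricExchange (positiveParts 𝓕) := by
  rw [symmetricExchange_iff_forall_isEdgePair, feasiblePolytope_eq_convexHull h𝓕]
  refine ⟨fun h A B hAB => ?_, fun h Q hQ => ?_⟩
  · obtain ⟨Q, hQ, hspan⟩ := hAB.exists_isEdge
    have := h Q hQ
    rw [exists_isParallelTo_single_iff hspan, isParallelToPair_iff hspan] at this
    omega
  · obtain ⟨A, B, hAB, hspan⟩ := exists_isEdgePair_of_isEdge hQ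
    have hle := h A B hAB
    have hpos : (A ∆ B).card ≠ 0 := by simpa using hAB.ne
    rw [exists_isParallelTo_single_iff hspan, isParallelToPair_iff hspan]
    omega

end AdS

namespace DeltaMatroid

open SignVec AdS

variable {n : ℕ}

theorem symmetricExchange (D : DeltaMatroid n) : SymmetricExchange (positiveParts D.feasible) :=
  (forall_isEdge_isParallelTo_iff D.card_eq).1 D.edges

theorem isSupportFunction (D : DeltaMatroid n) :
    IsSupportFunction (positiveParts D.feasible) fun s => D.rank (signVec.symm s) := fun s => by
  have hpairing (A : Finset (Fin n)) := card_inter_sub_card_bar_inter (signVec.symm s) A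
  simp only [Equiv.apply_symm_apply] at hpairing
  constructor
  · obtain ⟨B, hB, hBs⟩ := Finset.exists_mem_eq_sup' D.nonempty
      fun B : AdS n => (((signVec.symm s).1 ∩ B.1).card : ℤ) - ((signVec.symm s).bar ∩ B.1).card
    obtain ⟨A, rfl⟩ := exists_signVec_symm_vertex_eq (D.card_eq B hB)
    exact ⟨A, hB, (hBs.trans (hpairing A)).symm⟩
  · rintro _ ⟨A, hA, rfl⟩
    rw [← hpairing A]
    exact Finset.le_sup' (fun B : AdS n => (((signVec.symm s).1 ∩ B.1).card : ℤ) -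
      ((signVec.symm s).bar ∩ B.1).card) hA

theorem isRankFunction (D : DeltaMatroid n) :
    IsRankFunction fun s => D.rank (signVec.symm s) :=
  D.isSupportFunction.isRankFunction D.symmetricExchange

theorem exists_feasible_eq {F : Set (Finset (Fin n))} (hne : F.Nonempty)
    (hF : SymmetricExchange F) : ∃ D : DeltaMatroid n, positiveParts D.feasible = F := by
  let 𝓕 : Finset (AdS n) := (Set.toFinite ((fun A => signVec.symm (vertex A)) '' F)).toFinset
  have hinj : Function.Injective fun A : Finset (Fin n) => signVec.symm (vertex A) :=
    signVec.symm.injective.comp vertex_injective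
  have h𝓕 : positiveParts 𝓕 = F := Set.ext fun A => by
    simpa [𝓕, positiveParts] using hinj.mem_set_image
  have hcard : ∀ B ∈ 𝓕, B.1.card = n := fun B hB => by
    obtain ⟨A, -, rfl⟩ := (Set.Finite.mem_toFinset _).1 hB
    exact card_signVec_symm_vertex A
  exact ⟨⟨𝓕, by simpa [𝓕] using hne, hcard,
    (forall_isEdge_isParallelTo_iff hcard).2 (h𝓕 ▸ hF)⟩, h𝓕⟩

theorem exists_eq_rank {g : AdS n → ℤ} (hg : IsRankFunction fun s => g (signVec.symm s)) :
    ∃ D : DeltaMatroid n, g = D.rank := by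
  have hsupport := hg.isSupportFunction_feasibleVertices
  obtain ⟨D, hD⟩ := exists_feasible_eq (Set.image_nonempty.1 ⟨_, (hsupport 0).1⟩)
    hg.symmetricExchange_feasibleVertices
  refine ⟨D, funext fun S => ?_⟩
  have := (hsupport (signVec S)).unique (hD ▸ D.isSupportFunction (signVec S))
  simpa only [Equiv.symm_apply_apply] using this

theorem isEven_iff_forall_isEdgePair (D : DeltaMatroid n) :
    D.IsEven ↔ ∀ A B, IsEdgePair (positiveParts D.feasible) A B → (A ∆ B).card = 2 := by
  rw [IsEven, polytope, feasiblePolytope_eq_convexHull D.card_eq]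
  refine ⟨fun h A B hAB => ?_, fun h Q hQ => ?_⟩
  · obtain ⟨Q, hQ, hspan⟩ := hAB.exists_isEdge
    exact (isParallelToPair_iff hspan).1 (h Q hQ)
  · obtain ⟨A, B, hAB, hspan⟩ := exists_isEdgePair_of_isEdge hQ
    exact (isParallelToPair_iff hspan).2 (h A B hAB)

theorem isEven_iff (D : DeltaMatroid n) : D.IsEven ↔
    ∀ (S : AdS n) (i : Fin n) (hi : Sum.inl i ∉ S.1) (hi' : Sum.inr i ∉ S.1), S.1.card + 1 = n →
      D.rank (S.adjoin (Sum.inl i) hi') + D.rank (S.adjoin (Sum.inr i) hi) = 2 * D.rank S := by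
  rw [D.isEven_iff_forall_isEdgePair,
    D.isSupportFunction.forall_isEdgePair_card_eq_two_iff D.symmetricExchange]
  have hinl (S : AdS n) (i) (hi : Sum.inr i ∉ S.1) :=
    signVec.symm_apply_eq.2 (signVec_adjoin_inl S i hi).symm
  have hinr (S : AdS n) (i) (hi : Sum.inl i ∉ S.1) :=
    signVec.symm_apply_eq.2 (signVec_adjoin_inr S i hi).symm
  refine ⟨fun h S i hi hi' hS => ?_, fun h s i hsi hs => ?_⟩
  · have hSi : signVec S i = 0 := signVec_apply_eq_zero_iff.2 ⟨hi, hi'⟩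
    simpa only [← hinl, ← hinr, Equiv.symm_apply_apply] using
      h (signVec S) i hSi ((card_add_one_eq_iff hSi).1 hS)
  · have hSi : signVec (signVec.symm s) i = 0 := by rwa [Equiv.apply_symm_apply]
    obtain ⟨hi, hi'⟩ := signVec_apply_eq_zero_iff.1 hSi
    have := h (signVec.symm s) i hi hi' ((card_add_one_eq_iff hSi).2 (by simpa using hs))
    simpa only [← hinl, ← hinr, Equiv.apply_symm_apply] using this

end DeltaMatroid

theorem theorem1p2 (n : ℕ) :
    (∀ g : AdS n → ℤ,
      (∃ D : DeltaMatroid n, g = D.rank) ↔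
        g (AdS.empty n) = 0 ∧
        (∀ S : AdS n, S.1.card = 1 → |g S| ≤ 1) ∧
        IsBisubmodular g ∧
        (∀ S : AdS n, g S ≡ (S.1.card : ℤ) [ZMOD 2])) ∧
    (∀ D : DeltaMatroid n,
      D.IsEven ↔
        ∀ (S : AdS n) (i : Fin n) (hi : Sum.inl i ∉ S.1) (hi' : Sum.inr i ∉ S.1),
          S.1.card + 1 = n →
            (D.rank S : ℝ) =
              ((D.rank (S.adjoin (Sum.inl i) hi') : ℝ) +
                (D.rank (S.adjoin (Sum.inr i) hi) : ℝ)) / 2) := by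
  refine ⟨fun g => ?_, fun D => ?_⟩
  · rw [← AdS.isRankFunction_comp_signVec_symm_iff]
    exact ⟨fun ⟨D, hD⟩ => hD ▸ D.isRankFunction, DeltaMatroid.exists_eq_rank⟩
  · rw [D.isEven_iff]
    refine forall₅_congr fun S i hi hi' hS => ?_
    rw [eq_div_iff two_ne_zero, mul_comm, eq_comm]
    norm_cast
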